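/- Let $F$ be an arbitrary field; all Lie algebras below are finite-dimensional over $F$ and soluble. A \emph{formation} is a class $\mathfrak F$ of such Lie algebras which is closed under homomorphic images (in particular under isomorphism) and such that $L/I\in\mathfrak F$ and $L/J\in\mathfrak F$ for ideals $I,J$ of $L$ imply $L/(I\cap J)\in\mathfrak F$. It is \emph{saturated} if $L/\Phi(L)\in\mathfrak F$ implies $L\in\mathfrak F$, where the Frattini subalgebra $\Phi(L)$ is the intersection of all maximal subalgebras of $L$ (it is an ideal, as $L$ is soluble). A chief factor $A/B$ of $L$ (that is, $B<A$ are ideals of $L$ with no ideal of $L$ strictly between them) is \emph{$\mathfrak F$-central} if the split extension of $A/B$ by $L/\mathcal C_L(A/B)$ is in $\mathfrak F$, where $\mathcal C_L(A/B)=\{x\in L : [x,A]\subseteq B\}$. A maximal subalgebra $M$ of $L$ is \emph{$\mathfrak F$-normal} if it complements some $\mathfrak F$-central chief factor $A/B$ of $L$ (that is, $M+A=L$ and $M\cap A=B$), and \emph{$\mathfrak F$-abnormal} otherwise. A maximal subalgebra $M$ of $L$ is \emph{$\mathfrak F$-critical} in $L$ if it is $\mathfrak F$-abnormal and $M+N(L)=L$,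 where $N(L)$ is the nil radical of $L$, i.e. its largest nilpotent ideal. An \emph{$\mathfrak F$-normaliser} of $L$ is a subalgebra $V\le L$ with $V\in\mathfrak F$ for which there is a chain of subalgebras $L=M_0>M_1>\dots>M_n=V$, $n\ge 0$, with each $M_i$ $\mathfrak F$-critical in $M_{i-1}$. \textbf{Theorem.} Let $\mathfrak F$ be a saturated formation of soluble Lie algebras over $F$, let $L$ be a finite-dimensional soluble Lie algebra over $F$, and let $U$ be an $\mathfrak F$-normaliser of $L$. Then $U$ is intravariant in $L$: every derivation of $L$ is the sum of an inner derivation and a derivation $e$ of $L$ with $e(U)\subseteq U$. -/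

import Mathlib

universe u v

/-- A formation of soluble Lie algebras over the field `K`: a class of finite-dimensional soluble
Lie algebras closed under homomorphic images (in particular under isomorphism) and such that
`L/(I ∩ J)` is in the class whenever `L/I` and `L/J` are. -/
structure LieFormation (K : Type v) [Field K] where
  Mem : ∀ (L : Type u) [LieRing L] [LieAlgebra K L], Prop
  finiteDimensional : ∀ (L : Type u) [LieRing L] [LieAlgebra K L], Mem L → FiniteDimensional K L
  isSolvable : ∀ (L : Type u) [LieRing L] [LieAlgebra K L], Mem L → LieAlgebra.IsSolvable L
  of_surjective : ∀ (L L' : Type u) [LieRing L] [LieAlgebra K L] [LieRing L'] [LieAlgebra K L']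
    (f : L →ₗ⁅K⁆ L'), Function.Surjective f → Mem L → Mem L'
  quotient_inf : ∀ (L : Type u) [LieRing L] [LieAlgebra K L] [FiniteDimensional K L]
    [LieAlgebra.IsSolvable L] (I J : LieIdeal K L), Mem (L ⧸ I) → Mem (L ⧸ J) → Mem (L ⧸ (I ⊓ J))

section LieTheory

variable (K : Type v) [Field K] (L : Type u) [LieRing L] [LieAlgebra K L]

/-- The Frattini subalgebra: the intersection of all maximal subalgebras. -/
def LieAlgebra.frattiniSubalgebra : LieSubalgebra K L :=
  sInf {M : LieSubalgebra K L | IsCoatom M}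

/-- The nil radical: the sum of all ideals that are nilpotent as Lie algebras. (Mathlib's
`LieAlgebra.maxNilpotentIdeal` is about ideals nilpotent as `L`-modules, a different notion.) -/
def LieAlgebra.nilpotentRadical : LieIdeal K L :=
  sSup {I : LieIdeal K L | LieRing.IsNilpotent I}

variable {K L}

/-- The core of a subalgebra: the largest ideal of `L` contained in it. -/
def LieSubalgebra.idealCore (M : LieSubalgebra K L) : LieIdeal K L :=
  sSup {I : LieIdeal K L | I.toSubmodule ≤ M.toSubmodule}

/-- `U` is intravariant in `L`: every derivation of `L` is the sum of an inner derivation and a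
derivation which stabilises `U`. -/
def LieSubalgebra.IsIntravariant (U : LieSubalgebra K L) : Prop :=
  ∀ d : LieDerivation K L L, ∃ (x : L) (e : LieDerivation K L L),
    d = LieDerivation.ad K L x + e ∧ ∀ y ∈ U, e y ∈ U

/-- `A/B` as a Lie algebra, for ideals `A`, `B` of `L` (meaningful when `B ≤ A`). -/
abbrev LieIdeal.Factor (A B : LieIdeal K L) : Type u :=
  A ⧸ LieIdeal.comap A.incl B

/-- The derivation of `A/B` induced by `x ∈ L`, sending `a + B` to `⁅x, a⁆ + B`. -/
def LieIdeal.factorDerivation (A B : LieIdeal K L) (x : L) :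
    LieDerivation K (A.Factor B) (A.Factor B) where
  toLinearMap := Submodule.mapQ (LieIdeal.comap A.incl B).toSubmodule
    (LieIdeal.comap A.incl B).toSubmodule (LieModule.toEnd K L A x) (by
      intro a ha
      change (⁅x, (a : L)⁆ : L) ∈ B
      exact lie_mem_right K L B x a ha)
  leibniz' := by
    intro a b
    induction a using Submodule.Quotient.induction_on with | _ a
    induction b using Submodule.Quotient.induction_on with | _ b
    change (LieSubmodule.Quotient.mk (⁅x, ⁅a, b⁆⁆ : A) : A.Factor B) =
      LieSubmodule.Quotient.mk (⁅a, (⁅x, b⁆ : A)⁆ - ⁅b, (⁅x, a⁆ : A)⁆ : A)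
    congr 1
    apply Subtype.ext
    change ⁅x, ⁅(a : L), (b : L)⁆⁆ = ⁅(a : L), ⁅x, (b : L)⁆⁆ - ⁅(b : L), ⁅x, (a : L)⁆⁆
    rw [leibniz_lie, ← lie_skew (b : L) ⁅x, (a : L)⁆]
    abel

theorem LieIdeal.factorDerivation_mk (A B : LieIdeal K L) (x : L) (a : A) :
    A.factorDerivation B x (LieSubmodule.Quotient.mk a) =
      (LieSubmodule.Quotient.mk (⁅x, a⁆ : A) : A.Factor B) := rfl

/-- The action of `L` on `A/B`. Its kernel is the centraliser `C_L(A/B) = {x | ⁅x, A⁆ ⊆ B}`. -/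
def LieIdeal.factorAction (A B : LieIdeal K L) :
    L →ₗ⁅K⁆ LieDerivation K (A.Factor B) (A.Factor B) where
  toFun := A.factorDerivation B
  map_add' x y := by
    ext a
    induction a using Submodule.Quotient.induction_on with | _ a
    rw [LieDerivation.add_apply]
    simp only [LieIdeal.factorDerivation_mk, add_lie]
    rfl
  map_smul' t x := by
    ext a
    induction a using Submodule.Quotient.induction_on with | _ a
    rw [RingHom.id_apply, LieDerivation.smul_apply]
    simp only [LieIdeal.factorDerivation_mk, smul_lie]
    rfl
  map_lie' {x y} := by
    ext a
    induction a using Submodule.Quotient.induction_on with | _ a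
    rw [LieDerivation.commutator_apply]
    simp only [LieIdeal.factorDerivation_mk, lie_lie]
    rfl

/-- The faithful action of `L/C_L(A/B)` on `A/B`. -/
noncomputable def LieIdeal.factorFaithfulAction (A B : LieIdeal K L) :
    (L ⧸ (A.factorAction B).ker) →ₗ⁅K⁆ LieDerivation K (A.Factor B) (A.Factor B) :=
  (A.factorAction B).range.incl.comp (A.factorAction B).quotKerEquivRange.toLieHom

/-- The split extension of `A/B` by `L/C_L(A/B)`. -/
abbrev LieIdeal.FactorSplitExtension (A B : LieIdeal K L) : Type u :=
  LieAlgebra.SemiDirectSum (A.Factor B) (L ⧸ (A.factorAction B).ker) (A.factorFaithfulAction B)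

end LieTheory

namespace LieFormation

variable {K : Type v} [Field K] (F : LieFormation.{u, v} K)

/-- `F` is saturated: `L/Φ(L) ∈ F` implies `L ∈ F`. Here `L/Φ(L)` is the quotient by the largest
ideal contained in the Frattini subalgebra `Φ(L)`; for finite-dimensional soluble `L`, the subalgebra
`Φ(L)` is itself an ideal. -/
def IsSaturated : Prop :=
  ∀ (L : Type u) [LieRing L] [LieAlgebra K L] [FiniteDimensional K L] [LieAlgebra.IsSolvable L],
    F.Mem (L ⧸ (LieAlgebra.frattiniSubalgebra K L).idealCore) → F.Mem L

variable {L : Type u} [LieRing L] [LieAlgebra K L]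

/-- `A/B` is an `F`-central chief factor of `L`: there is no ideal of `L` strictly between `B < A`,
and the split extension of `A/B` by `L/C_L(A/B)` is in `F`. -/
def IsCentralChiefFactor (A B : LieIdeal K L) : Prop :=
  B ⋖ A ∧ F.Mem (A.FactorSplitExtension B)

/-- The maximal subalgebra `M` is `F`-normal: it complements an `F`-central chief factor. -/
def IsNormalMaximal (M : LieSubalgebra K L) : Prop :=
  IsCoatom M ∧ ∃ A B : LieIdeal K L, F.IsCentralChiefFactor A B ∧
    M.toSubmodule ⊔ A.toSubmodule = ⊤ ∧ M.toSubmodule ⊓ A.toSubmodule = B.toSubmodule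

/-- The maximal subalgebra `M` is `F`-abnormal: it is not `F`-normal. -/
def IsAbnormalMaximal (M : LieSubalgebra K L) : Prop :=
  IsCoatom M ∧ ¬ F.IsNormalMaximal M

/-- `M` is `F`-critical in `L`: an `F`-abnormal maximal subalgebra with `M + N(L) = L`. -/
def IsCritical (M : LieSubalgebra K L) : Prop :=
  F.IsAbnormalMaximal M ∧
    M.toSubmodule ⊔ (LieAlgebra.nilpotentRadical K L).toSubmodule = ⊤

/-- `V` is an `F`-normaliser of `L`: `V ∈ F` and there is a chain `L = M₀ > M₁ > ⋯ > Mₙ = V` of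
subalgebras with each `Mᵢ₊₁` an `F`-critical subalgebra of `Mᵢ`. -/
def IsNormaliser (V : LieSubalgebra K L) : Prop :=
  F.Mem V ∧ ∃ (n : ℕ) (M : ℕ → LieSubalgebra K L), M 0 = ⊤ ∧ M n = V ∧
    ∀ i < n, M (i + 1) < M i ∧ F.IsCritical ((M (i + 1)).comap (M i).incl)

end LieFormation

/-! In the split extension `G` of `L` by its derivation algebra, a derivation of `L` becomes
bracketing with an element `d`, so it suffices to find `x ∈ L` such that `d - x` normalises `U`.
Each term `M (k+1)` of the chain from `L` to `U` supplements a nilpotent ideal `A k` of `M k`, and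
`M k / M (k+1)` is irreducible.

Abnormality enters as vanishing cohomology: if `U` induces on such a factor `V` all operators of `M
(k+1)`, then derivations `U → V` are inner (`exists_inner_of_not_mem_factorSplitExtension`). For a
nontrivial action and a derivation killing its kernel, this is a Nakayama argument. Otherwise some
derivation maps the kernel onto `V`; then `V ⋊ U` has two ideals meeting trivially, modulo each of
which it is an image of `U`, so it lies in the formation and the factor is central.

The descent `exists_sub_normalises_of_chain` is an induction on the dimension of the top. If every
`A k` acts nilpotently on the top, Engel's theorem makes it centralise the earlier factors, so `U`
induces all operators and `d` is corrected factor by factor. Otherwise the chain is intersected with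
the Fitting null component of the first `A i` that fails: this contains `M i`, hence `U`, and
contains `d` up to an element of the top. -/

/-! ### Fitting components of a nilpotent subalgebra -/

section Fitting

variable {K : Type*} [Field K] {G : Type*} [LieRing G] [LieAlgebra K G]

/-- A subspace stable under a subalgebra `N`, as a Lie module over `N`. -/
def LieSubalgebra.stableSubmodule (N : LieSubalgebra K G) (X : Submodule K G)
    (hX : ∀ n ∈ N, ∀ x ∈ X, ⁅n, x⁆ ∈ X) : LieSubmodule K N G :=
  { X with lie_mem := fun {n x} hx => hX n n.2 x hx }

/-- Fitting decomposition of an element of an `N`-stable subspace `X`. -/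
theorem LieSubalgebra.exists_fitting_decomposition [FiniteDimensional K G] (N : LieSubalgebra K G)
    [LieRing.IsNilpotent N] {X Y : Submodule K G} (hX : ∀ n ∈ N, ∀ x ∈ X, ⁅n, x⁆ ∈ X)
    (hXY : ∀ n ∈ N, ∀ x ∈ X, ⁅n, x⁆ ∈ Y) {x : G} (hx : x ∈ X) :
    ∃ x₀ ∈ X, ∃ x₁ ∈ Y, x₀ ∈ LieAlgebra.zeroRootSubalgebra K G N ∧
      x₁ ∈ LieModule.posFittingComp K N G ∧ x = x₀ + x₁ := by
  let X' := N.stableSubmodule X hX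
  have hc := (LieModule.isCompl_genWeightSpace_zero_posFittingComp K N X').sup_eq_top
  have hx' : (⟨x, hx⟩ : X') ∈ LieModule.genWeightSpace X' (0 : N → K) ⊔
      LieModule.posFittingComp K N X' := by rw [hc]; trivial
  obtain ⟨a, ha, b, hb, hab⟩ := LieSubmodule.mem_sup _ _ _ |>.1 hx'
  refine ⟨a, a.2, b, ?_, ?_, ?_, ?_⟩
  -- The positive component lies in every lower central term, in particular in `⁅N, X⁆`, which is
  -- inside `Y`.
  · have h1 := (LieModule.posFittingComp_le_iInf_lowerCentralSeries K N X').trans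
      (iInf_le _ 1) hb
    rw [LieModule.lowerCentralSeries_succ] at h1
    have h2 : ((⁅(⊤ : LieIdeal K N), LieModule.lowerCentralSeries K N X' 0⁆ :
        LieSubmodule K N X') : Submodule K X') ≤ Y.comap (X' : Submodule K G).subtype := by
      rw [LieSubmodule.lieIdeal_oper_eq_linear_span, Submodule.span_le]
      rintro _ ⟨n, y, rfl⟩
      exact hXY _ n.1.2 _ y.1.2
    exact h2 h1
  · exact LieModule.map_genWeightSpace_le X'.incl (LieSubmodule.mem_map_of_mem ha)
  · exact LieModule.map_posFittingComp_le X'.incl (LieSubmodule.mem_map_of_mem hb)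
  · exact (congrArg Subtype.val hab).symm

theorem LieSubalgebra.eq_zero_of_mem_fitting [FiniteDimensional K G] (N : LieSubalgebra K G)
    [LieRing.IsNilpotent N] {x : G} (h₀ : x ∈ LieAlgebra.zeroRootSubalgebra K G N)
    (h₁ : x ∈ LieModule.posFittingComp K N G) : x = 0 := by
  have := (LieModule.isCompl_genWeightSpace_zero_posFittingComp K N G).inf_eq_bot
  have h : x ∈ LieModule.genWeightSpace G (0 : N → K) ⊓ LieModule.posFittingComp K N G := ⟨h₀, h₁⟩
  rw [this] at h
  exact h

/-- The Fitting null component is compatible with sums of stable subspaces. -/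
theorem LieSubalgebra.exists_add_of_mem_zeroRootSubalgebra [FiniteDimensional K G]
    (N : LieSubalgebra K G) [LieRing.IsNilpotent N] {X Y : Submodule K G}
    (hX : ∀ n ∈ N, ∀ x ∈ X, ⁅n, x⁆ ∈ X) (hY : ∀ n ∈ N, ∀ y ∈ Y, ⁅n, y⁆ ∈ Y) {x y : G}
    (hx : x ∈ X) (hy : y ∈ Y) (h : x + y ∈ LieAlgebra.zeroRootSubalgebra K G N) :
    ∃ x₀ ∈ X, ∃ y₀ ∈ Y, x₀ ∈ LieAlgebra.zeroRootSubalgebra K G N ∧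
      y₀ ∈ LieAlgebra.zeroRootSubalgebra K G N ∧ x + y = x₀ + y₀ := by
  obtain ⟨x₀, hx₀, x₁, -, h1, h2, rfl⟩ := N.exists_fitting_decomposition hX hX hx
  obtain ⟨y₀, hy₀, y₁, -, h3, h4, rfl⟩ := N.exists_fitting_decomposition hY hY hy
  refine ⟨x₀, hx₀, y₀, hy₀, h1, h3, ?_⟩
  have h5 : x₁ + y₁ = 0 := by
    refine N.eq_zero_of_mem_fitting ?_ (add_mem h2 h4)
    have : x₁ + y₁ = (x₀ + x₁ + (y₀ + y₁)) - (x₀ + y₀) := by abel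
    rw [this]
    exact sub_mem h (add_mem h1 h3)
  calc x₀ + x₁ + (y₀ + y₁) = x₀ + y₀ + (x₁ + y₁) := by abel
    _ = x₀ + y₀ := by rw [h5, add_zero]

/-- A subspace mapped by `N` into `N` lies in the Fitting null component of `N`. -/
theorem LieSubalgebra.mem_zeroRootSubalgebra_of_lie_mem (N : LieSubalgebra K G)
    [LieRing.IsNilpotent N] {x : G} (h : ∀ n ∈ N, ⁅n, x⁆ ∈ N) :
    x ∈ LieAlgebra.zeroRootSubalgebra K G N := by
  rw [LieAlgebra.mem_zeroRootSubalgebra]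
  intro n
  obtain ⟨k, hk⟩ := (LieAlgebra.mem_zeroRootSubalgebra K G N _).1
    (LieAlgebra.le_zeroRootSubalgebra K G N (h n n.2)) n
  exact ⟨k + 1, by rw [pow_succ]; exact hk⟩

/-- Engel: if `N` acts nilpotently on `X`, it has a nonzero invariant in a nonzero quotient of
`X`. -/
theorem LieSubalgebra.exists_invariant_of_le_zeroRootSubalgebra [FiniteDimensional K G]
    (N : LieSubalgebra K G) [LieRing.IsNilpotent N] {X Y : Submodule K G}
    (hX : ∀ n ∈ N, ∀ x ∈ X, ⁅n, x⁆ ∈ X)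
    (hX₀ : ∀ x ∈ X, x ∈ LieAlgebra.zeroRootSubalgebra K G N) (hXY : ¬ X ≤ Y) :
    ∃ x ∈ X, x ∉ Y ∧ ∀ n ∈ N, ⁅n, x⁆ ∈ Y := by
  classical
  let X' := N.stableSubmodule X hX
  have hnil : LieModule.IsNilpotent N X' := by
    rw [LieModule.isNilpotent_iff_forall (R := K)]
    intro n
    refine Module.End.isNilpotent_iff_of_finite.2 fun x => ?_
    obtain ⟨k, hk⟩ := (LieAlgebra.mem_zeroRootSubalgebra K G N _).1 (hX₀ x x.2) n
    refine ⟨k, Subtype.ext ?_⟩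
    exact (LieModule.toEnd_pow_apply_map (R := K) (f := X'.incl) k n x).symm.trans hk
  obtain ⟨k, hk⟩ := (LieModule.isNilpotent_iff K N X').1 hnil
  -- For the first lower central term inside `Y`, the preceding term supplies the invariant.
  have hex : ∃ k, ∀ x ∈ LieModule.lowerCentralSeries K N X' k, (x : G) ∈ Y :=
    ⟨k, fun x hx => by rw [hk] at hx; rw [(LieSubmodule.mem_bot x).1 hx]; exact Y.zero_mem⟩
  have hs := Nat.find_spec hex
  have hm := fun j => Nat.find_min hex (m := j)
  rcases hj : Nat.find hex with _ | j
  · rw [hj] at hs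
    exact absurd (fun x hx => hs ⟨x, hx⟩ (LieSubmodule.mem_top _)) hXY
  · rw [hj] at hs
    have := hm j (by omega)
    push Not at this
    obtain ⟨x, hx, hxY⟩ := this
    refine ⟨x, x.2, hxY, fun n hn => hs ⁅(⟨n, hn⟩ : N), x⁆ ?_⟩
    rw [LieModule.lowerCentralSeries_succ]
    exact LieSubmodule.lie_mem_lie (LieSubmodule.mem_top _) hx

end Fitting

/-! ### Descent along a chain of irreducible steps -/

section Chain

variable {K : Type*} [Field K] {G : Type*} [LieRing G] [LieAlgebra K G]

/-- `M = X + C_M(P/M)`, that is, `X` and `M` induce the same operators on `P/M`. -/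
def LieSubalgebra.CoversModCentraliser (X P M : LieSubalgebra K G) : Prop :=
  ∀ m ∈ M, ∃ x ∈ X, ∃ c ∈ M, (∀ y ∈ P, ⁅c, y⁆ ∈ M) ∧ x + c = m

/-- `M` is a subalgebra of `P` supplementing the nilpotent ideal `A` of `P`, the `M`-module `P/M` is
zero or irreducible and, if `U` induces on it the same operators as `M`, then every derivation
of `U` into `P/M` is inner. -/
structure LieSubalgebra.IsIrreducibleStep (U P M A : LieSubalgebra K G) : Prop where
  le : M ≤ P
  ideal_le : A ≤ P
  lie_mem : ∀ x ∈ P, ∀ a ∈ A, ⁅x, a⁆ ∈ A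
  isNilpotent : LieRing.IsNilpotent A
  exists_add : ∀ x ∈ P, ∃ m ∈ M, ∃ a ∈ A, m + a = x
  irreducible : ∀ W : Submodule K G, M.toSubmodule ≤ W → W ≤ P.toSubmodule →
    (∀ m ∈ M, ∀ w ∈ W, ⁅m, w⁆ ∈ W) → W = M.toSubmodule ∨ W = P.toSubmodule
  exists_inner : U.CoversModCentraliser P M → ∀ δ : U →ₗ[K] G, (∀ x, δ x ∈ P) →
    (∀ x y : U, δ ⁅x, y⁆ - (⁅(x : G), δ y⁆ - ⁅(y : G), δ x⁆) ∈ M) →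
    ∃ p ∈ P, ∀ x : U, δ x - ⁅(x : G), p⁆ ∈ M

namespace LieSubalgebra

/-- Intersecting a step with a Fitting null component gives a step. -/
theorem IsIrreducibleStep.inf_zeroRootSubalgebra [FiniteDimensional K G]
    {U P M A X N : LieSubalgebra K G} (h : IsIrreducibleStep U P M A) [LieRing.IsNilpotent N]
    (hNM : N ≤ M) (hUX : U ≤ X) (hXM : X ≤ M) (hX₀ : X ≤ LieAlgebra.zeroRootSubalgebra K G N)
    (hX : X.CoversModCentraliser P M) :
    IsIrreducibleStep U (P ⊓ LieAlgebra.zeroRootSubalgebra K G N)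
      (M ⊓ LieAlgebra.zeroRootSubalgebra K G N) (A ⊓ LieAlgebra.zeroRootSubalgebra K G N) := by
  set G₀ := LieAlgebra.zeroRootSubalgebra K G N
  have hNP : N ≤ P := hNM.trans h.le
  -- Operators of `M` on `P/M` already come from `X ≤ M ⊓ G₀`, so irreducibility of `P/M` applies to
  -- subspaces stable only under `M ⊓ G₀`.
  have key : ∀ W : Submodule K G, W ≤ P.toSubmodule →
      (∀ m ∈ M ⊓ G₀, ∀ w ∈ W, ⁅m, w⁆ ∈ W ⊔ M.toSubmodule) →
      W ⊔ M.toSubmodule = M.toSubmodule ∨ W ⊔ M.toSubmodule = P.toSubmodule := by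
    intro W hWP hW
    refine h.irreducible _ le_sup_right (sup_le hWP h.le) fun m hm w hw => ?_
    obtain ⟨w₁, hw₁, m', hm', rfl⟩ := Submodule.mem_sup.1 hw
    rw [lie_add]
    refine add_mem ?_ (Submodule.mem_sup_right (M.lie_mem hm hm'))
    obtain ⟨x, hx, c, -, hc, rfl⟩ := hX m hm
    rw [add_lie]
    exact add_mem (hW x ⟨hXM hx, hX₀ hx⟩ w₁ hw₁) (Submodule.mem_sup_right (hc w₁ (hWP hw₁)))
  -- The intersected factor is either zero or all of `P/M`.
  have hP₀ : (P ⊓ G₀).toSubmodule ≤ M.toSubmodule ∨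
      (P ⊓ G₀).toSubmodule ⊔ M.toSubmodule = P.toSubmodule := by
    refine (key (P ⊓ G₀).toSubmodule (fun x hx => hx.1) fun m hm w hw => ?_).imp_left
      fun h => le_sup_left.trans h.le
    exact Submodule.mem_sup_left
      ((P ⊓ G₀).lie_mem (show m ∈ P ⊓ G₀ from ⟨h.le hm.1, hm.2⟩) hw)
  refine ⟨fun x hx => ⟨h.le hx.1, hx.2⟩, fun x hx => ⟨h.ideal_le hx.1, hx.2⟩,
    fun x hx a ha => ⟨h.lie_mem x hx.1 a ha.1, G₀.lie_mem hx.2 ha.2⟩, ?_, ?_, ?_, ?_⟩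
  · have := h.isNilpotent
    exact (LieSubalgebra.inclusion_injective
      (show A ⊓ G₀ ≤ A from inf_le_left)).lieAlgebra_isNilpotent
  · intro x hx
    obtain ⟨m, hm, a, ha, rfl⟩ := h.exists_add x hx.1
    obtain ⟨m₀, hm₀, a₀, ha₀, h1, h2, h3⟩ := N.exists_add_of_mem_zeroRootSubalgebra
      (X := M.toSubmodule) (Y := A.toSubmodule) (fun n hn x hx => M.lie_mem (hNM hn) hx)
      (fun n hn x hx => h.lie_mem n (hNP hn) x hx) hm ha hx.2
    exact ⟨m₀, ⟨hm₀, h1⟩, a₀, ⟨ha₀, h2⟩, h3.symm⟩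
  · intro W hMW hWP hW
    rcases key W (fun x hx => (hWP hx).1) fun m hm w hw => Submodule.mem_sup_left (hW m hm w hw)
      with h1 | h1
    · left
      refine le_antisymm (fun w hw => ⟨?_, (hWP hw).2⟩) hMW
      exact h1.le (Submodule.mem_sup_left hw)
    · right
      refine le_antisymm hWP fun x hx => ?_
      obtain ⟨w, hw, m, hm, rfl⟩ := Submodule.mem_sup.1 (h1.ge hx.1)
      refine add_mem hw (hMW ⟨hm, ?_⟩)
      have : m = (w + m) - w := by abel
      rw [this]
      exact sub_mem hx.2 (hWP hw).2
  · intro hU δ hδ hδ'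
    rcases hP₀ with h1 | h1
    · exact ⟨0, zero_mem _, fun x => by
        rw [lie_zero, sub_zero]; exact ⟨h1 (hδ x), (hδ x).2⟩⟩
    · have hcov : U.CoversModCentraliser P M := by
        intro m hm
        obtain ⟨x, hx, c, hc, hcP, rfl⟩ := hX m hm
        obtain ⟨u, hu, c', hc', hcP', rfl⟩ := hU x ⟨hXM hx, hX₀ hx⟩
        refine ⟨u, hu, c' + c, add_mem hc'.1 hc, fun y hy => ?_, by abel⟩
        rw [add_lie]
        refine add_mem ?_ (hcP y hy)
        obtain ⟨y₁, hy₁, m, hm, rfl⟩ := Submodule.mem_sup.1 (h1.ge hy)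
        rw [lie_add]
        exact add_mem (hcP' y₁ hy₁).1 (M.lie_mem hc'.1 hm)
      obtain ⟨p, hp, hpM⟩ := h.exists_inner hcov δ (fun x => (hδ x).1) (fun x y => (hδ' x y).1)
      obtain ⟨p₁, hp₁, m, hm, rfl⟩ := Submodule.mem_sup.1 (h1.ge hp)
      refine ⟨p₁, hp₁, fun x => ?_⟩
      have hxX := hUX x.2
      have h2 := add_mem (hpM x) (M.lie_mem (hXM hxX) hm)
      rw [lie_add] at h2
      refine ⟨?_, sub_mem (hδ x).2 (G₀.lie_mem (hX₀ hxX) hp₁.2)⟩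
      have h3 : δ x - ⁅(x : G), p₁⁆ = δ x - (⁅(x : G), p₁⁆ + ⁅(x : G), m⁆) + ⁅(x : G), m⁆ := by abel
      rw [h3]
      exact h2

/-- If the supplements of all later steps act nilpotently on `P`, the later terms of the chain
induce on `P/M` the same operators as `M`. -/
theorem IsIrreducibleStep.coversModCentraliser_succ [FiniteDimensional K G]
    {U P M A X Y B U' : LieSubalgebra K G} (h : IsIrreducibleStep U P M A)
    (h' : IsIrreducibleStep U' X Y B) (hXM : X ≤ M) (hX : X.CoversModCentraliser P M)
    (hB : have := h'.isNilpotent; P ≤ LieAlgebra.zeroRootSubalgebra K G B) :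
    Y.CoversModCentraliser P M := by
  have := h'.isNilpotent
  have hBM : B ≤ M := h'.ideal_le.trans hXM
  -- The `B`-invariants of `P/M` form an `M`-submodule because `X` normalises `B`; Engel makes them
  -- nonzero when `P/M` is, so `B` acts trivially.
  have hBP : ∀ b ∈ B, ∀ y ∈ P, ⁅b, y⁆ ∈ M := by
    let W : Submodule K G :=
      { carrier := {y | y ∈ P ∧ ∀ b ∈ B, ⁅b, y⁆ ∈ M}
        add_mem' := fun {x y} hx hy => ⟨add_mem hx.1 hy.1, fun b hb => by
          rw [lie_add]; exact add_mem (hx.2 b hb) (hy.2 b hb)⟩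
        zero_mem' := ⟨zero_mem _, fun b _ => by rw [lie_zero]; exact zero_mem _⟩
        smul_mem' := fun t x hx => ⟨P.smul_mem t hx.1, fun b hb => by
          rw [lie_smul]; exact M.smul_mem t (hx.2 b hb)⟩ }
    have hMW : M.toSubmodule ≤ W := fun m hm => ⟨h.le hm, fun b hb => M.lie_mem (hBM hb) hm⟩
    rcases h.irreducible W hMW (fun x hx => hx.1) fun m hm w hw => by
        obtain ⟨x, hx, c, hcM, hc, rfl⟩ := hX m hm
        rw [add_lie]
        refine add_mem ⟨P.lie_mem (h.le (hXM hx)) hw.1, fun b hb => ?_⟩ (hMW (hc w hw.1))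
        rw [leibniz_lie]
        refine add_mem ?_ (M.lie_mem (hXM hx) (hw.2 b hb))
        refine hw.2 _ ?_
        rw [← lie_skew]
        exact neg_mem (h'.lie_mem x hx b hb) with h1 | h1
    · by_cases hPM : P ≤ M
      · exact fun b hb y hy => M.lie_mem (hBM hb) (hPM hy)
      · obtain ⟨y, hyP, hyM, hy⟩ := B.exists_invariant_of_le_zeroRootSubalgebra
          (X := P.toSubmodule) (Y := M.toSubmodule)
          (fun b hb x hx => P.lie_mem (h.le (hBM hb)) hx) hB hPM
        exact absurd (h1.le (show y ∈ W from ⟨hyP, hy⟩)) hyM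
    · exact fun b hb y hy => (h1.ge hy : y ∈ W).2 b hb
  intro m hm
  obtain ⟨x, hx, c, hc, hcP, rfl⟩ := hX m hm
  obtain ⟨y, hy, b, hb, rfl⟩ := h'.exists_add x hx
  exact ⟨y, hy, b + c, add_mem (hBM hb) hc, fun z hz => by
    rw [add_lie]; exact add_mem (hBP b hb z hz) (hcP z hz), by abel⟩

/-- Along a chain of steps whose supplements act nilpotently on its top, every later term induces
on each factor of the chain the same operators. -/
theorem coversModCentraliser_of_chain [FiniteDimensional K G] {U : LieSubalgebra K G} {n i : ℕ}
    {M A : ℕ → LieSubalgebra K G} (h : ∀ k < n, IsIrreducibleStep U (M k) (M (k + 1)) (A k))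
    (hM : ∀ k l, k ≤ l → l ≤ n → M l ≤ M k) (hi : i ≤ n)
    (hA : ∀ k (hk : k < i), have := (h k (hk.trans_le hi)).isNilpotent
      M 0 ≤ LieAlgebra.zeroRootSubalgebra K G (A k))
    {j k : ℕ} (hjk : j < k) (hki : k ≤ i) :
    (M k).CoversModCentraliser (M j) (M (j + 1)) := by
  induction k, hjk using Nat.le_induction with
  | base => exact fun m hm => ⟨m, hm, 0, zero_mem _, fun y _ => by
      rw [zero_lie]; exact zero_mem _, add_zero m⟩
  | succ k hjk ih =>
    exact (h j (by omega)).coversModCentraliser_succ (h k (by omega)) (hM _ _ hjk (by omega))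
      (ih (by omega)) ((hM 0 j (by omega) (by omega)).trans (hA k (by omega)))

/-- An element normalising the top of a chain of steps normalises its bottom modulo the top. -/
theorem exists_sub_normalises_of_chain [FiniteDimensional K G] {U : LieSubalgebra K G} {n : ℕ}
    (M A : ℕ → LieSubalgebra K G) (h : ∀ k < n, IsIrreducibleStep U (M k) (M (k + 1)) (A k))
    (hn : M n = U) (d : G) (hd : ∀ x ∈ M 0, ⁅d, x⁆ ∈ M 0) :
    ∃ x ∈ M 0, ∀ u ∈ U, ⁅d - x, u⁆ ∈ U := by
  induction hr : Module.finrank K (M 0) using Nat.strong_induction_on generalizing M A d with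
  | _ r ih =>
  have hM : ∀ k l, k ≤ l → l ≤ n → M l ≤ M k := by
    intro k l hkl
    induction l, hkl using Nat.le_induction with
    | base => exact fun _ => le_rfl
    | succ l _ ih => exact fun hl => (h l (by omega)).le.trans (ih (by omega))
  have hUM : ∀ k ≤ n, U ≤ M k := fun k hk => hn ▸ hM k n hk le_rfl
  by_cases hall : ∀ k (hk : k < n), have := (h k hk).isNilpotent
      M 0 ≤ LieAlgebra.zeroRootSubalgebra K G (A k)
  · have main : ∀ j ≤ n, ∃ x ∈ M 0, ∀ u ∈ U, ⁅d - x, u⁆ ∈ M j := by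
      intro j
      induction j with
      | zero => exact fun _ => ⟨0, zero_mem _, fun u hu => by
          rw [sub_zero]; exact hd u (hUM 0 (Nat.zero_le _) hu)⟩
      | succ j ih =>
        intro hj
        obtain ⟨x, hx, hxU⟩ := ih (by omega)
        have hcov := coversModCentraliser_of_chain h hM le_rfl hall (j := j) (k := n) hj le_rfl
        rw [hn] at hcov
        -- Modulo `M (j + 1)`, the bracket with `d - x` is a derivation of `U`, hence inner;
        -- subtracting it pushes the image one term down.
        let δ : U →ₗ[K] G := (LieAlgebra.ad K G (d - x)).comp U.toSubmodule.subtype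
        have hδ : ∀ y : U, δ y = ⁅d - x, (y : G)⁆ := fun _ => rfl
        obtain ⟨p, hp, hpM⟩ := (h j hj).exists_inner hcov δ (fun y => hxU y y.2) fun y z => by
          rw [hδ, hδ, hδ, LieSubalgebra.coe_bracket, leibniz_lie (d - x) (y : G) (z : G),
            ← lie_skew (z : G) ⁅d - x, (y : G)⁆]
          convert zero_mem (M (j + 1)) using 1
          abel
        refine ⟨x - p, sub_mem hx (hM 0 j (by omega) (by omega) hp), fun u hu => ?_⟩
        have := hpM ⟨u, hu⟩
        rw [hδ, ← lie_skew _ p, sub_neg_eq_add, ← add_lie] at this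
        rwa [← sub_add]
    obtain ⟨x, hx, hxU⟩ := main n le_rfl
    exact ⟨x, hx, fun u hu => hn ▸ hxU u hu⟩
  · have hex : ∃ i, ∃ hi : i < n, have := (h i hi).isNilpotent
        ¬ M 0 ≤ LieAlgebra.zeroRootSubalgebra K G (A i) := by push Not at hall; exact hall
    classical
    obtain ⟨i, ⟨hi, hnot⟩, hmin⟩ : ∃ i, (∃ hi : i < n, have := (h i hi).isNilpotent
        ¬ M 0 ≤ LieAlgebra.zeroRootSubalgebra K G (A i)) ∧ ∀ k < i, ¬ (∃ hi : k < n,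
        have := (h k hi).isNilpotent
        ¬ M 0 ≤ LieAlgebra.zeroRootSubalgebra K G (A k)) :=
      ⟨Nat.find hex, Nat.find_spec hex, fun k hk => Nat.find_min hex hk⟩
    have := (h i hi).isNilpotent
    set N := A i
    set G₀ := LieAlgebra.zeroRootSubalgebra K G N
    have hA : ∀ k (hk : k < i), have := (h k (hk.trans hi)).isNilpotent
        M 0 ≤ LieAlgebra.zeroRootSubalgebra K G (A k) := fun k hk => by
      by_contra hc
      exact hmin k hk ⟨hk.trans hi, hc⟩
    have hNM : N ≤ M i := (h i hi).ideal_le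
    have hN0 : N ≤ M 0 := hNM.trans (hM 0 i (Nat.zero_le _) hi.le)
    -- `M i` normalises the nilpotent algebra `N`.
    have hMG : M i ≤ G₀ := fun m hm => N.mem_zeroRootSubalgebra_of_lie_mem fun x hx => by
      rw [← lie_skew]; exact neg_mem ((h i hi).lie_mem m hm x hx)
    have hstep : ∀ k < n, IsIrreducibleStep U (M k ⊓ G₀) (M (k + 1) ⊓ G₀) (A k ⊓ G₀) := by
      intro k hk
      -- Above `i`, minimality makes `M i ≤ G₀` induce all operators on the factors; from `i` on,
      -- intersecting with `G₀` changes nothing.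
      rcases lt_or_ge k i with hki | hki
      · exact (h k hk).inf_zeroRootSubalgebra (hNM.trans (hM _ _ hki hi.le)) (hUM i hi.le)
          (hM _ _ hki hi.le) hMG
          (coversModCentraliser_of_chain h hM hi.le hA hki le_rfl)
      · have h1 := (hM i k hki hk.le).trans hMG
        rw [inf_eq_left.2 h1, inf_eq_left.2 ((h k hk).le.trans h1),
          inf_eq_left.2 ((h k hk).ideal_le.trans h1)]
        exact h k hk
    -- As `N` sends `d` into `M 0`, the positive Fitting part of `d` lies in `M 0` and can be
    -- absorbed into the element sought.
    have hQ : ∀ y ∈ N, ∀ x ∈ (M 0).toSubmodule ⊔ K ∙ d, ⁅y, x⁆ ∈ M 0 := by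
      intro y hy x hx
      obtain ⟨m, hm, z, hz, rfl⟩ := Submodule.mem_sup.1 hx
      obtain ⟨t, rfl⟩ := Submodule.mem_span_singleton.1 hz
      rw [lie_add, lie_smul, ← lie_skew y d]
      exact add_mem ((M 0).lie_mem (hN0 hy) hm)
        ((M 0).smul_mem t (neg_mem (hd y (hN0 hy))))
    obtain ⟨d₀, -, x, hx, hd₀, -, rfl⟩ := N.exists_fitting_decomposition
      (X := (M 0).toSubmodule ⊔ K ∙ d) (Y := (M 0).toSubmodule)
      (fun y hy x hx => Submodule.mem_sup_left (hQ y hy x hx)) hQ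
      (show d ∈ _ from Submodule.mem_sup_right (Submodule.mem_span_singleton_self d))
    have hlt : Module.finrank K ↥(M 0 ⊓ G₀) < r := by
      rw [← hr]
      exact Submodule.finrank_lt_finrank_of_lt
        (lt_of_le_of_ne (fun x hx => hx.1) fun he => hnot fun x hx => (he.ge hx : x ∈ M 0 ⊓ G₀).2)
    obtain ⟨y, hy, hyU⟩ := ih _ hlt (fun k => M k ⊓ G₀) (fun k => A k ⊓ G₀) hstep
      (by rw [hn]; exact inf_eq_left.2 ((hUM i hi.le).trans hMG)) d₀ (fun z hz => ⟨by
        have := sub_mem (hd z hz.1) ((M 0).lie_mem hx hz.1)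
        rwa [add_lie, add_sub_cancel_right] at this, G₀.lie_mem hd₀ hz.2⟩) rfl
    refine ⟨x + y, add_mem hx hy.1, fun u hu => ?_⟩
    have h1 : d₀ + x - (x + y) = d₀ - y := by abel
    rw [h1]
    exact hyU u hu

end LieSubalgebra
end Chain

/-! ### Derivations of soluble algebras into irreducible modules -/

section Cohomology

variable {K : Type*} [Field K] {U : Type*} [LieRing U] [LieAlgebra K U]
  {V : Type*} [AddCommGroup V] [LieRingModule U V]

/-- A soluble Lie algebra acting nontrivially on a module has an ideal which acts nontrivially and
whose elements commute on the module. -/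
theorem LieAlgebra.exists_ideal_commute_of_isSolvable [LieAlgebra.IsSolvable U]
    (hV : ∃ (u : U) (w : V), ⁅u, w⁆ ≠ 0) :
    ∃ I : LieIdeal K U, (∃ u ∈ I, ∃ w : V, ⁅u, w⁆ ≠ 0) ∧
      ∀ x ∈ I, ∀ y ∈ I, ∀ w : V, ⁅⁅x, y⁆, w⁆ = 0 := by
  classical
  obtain ⟨k, hk⟩ := (LieAlgebra.isSolvable_iff K U).1 inferInstance
  -- The ideal wanted is the last derived term acting nontrivially.
  have hex : ∃ k, ∀ x ∈ LieAlgebra.derivedSeries K U k, ∀ w : V, ⁅x, w⁆ = 0 :=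
    ⟨k, fun x hx w => by rw [hk] at hx; rw [(LieSubmodule.mem_bot x).1 hx, zero_lie]⟩
  have hs := Nat.find_spec hex
  have hm := fun j => Nat.find_min hex (m := j)
  rcases hj : Nat.find hex with _ | j
  · rw [hj] at hs
    obtain ⟨u, w, h⟩ := hV
    exact absurd (hs u (LieSubmodule.mem_top _) w) h
  · rw [hj] at hs
    have := hm j (by omega)
    push Not at this
    obtain ⟨x, hx, w, hw⟩ := this
    refine ⟨_, ⟨x, hx, w, hw⟩, fun x hx y hy w => hs _ ?_ w⟩
    rw [LieAlgebra.derivedSeries_def, LieAlgebra.derivedSeriesOfIdeal_succ]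
    exact LieSubmodule.lie_mem_lie hx hy

variable [Module K V] [LieModule K U V]

open scoped IsMulCommutative in
/-- If the ideal `I` acts on `V` by commuting operators and `I V = V`, a derivation `U → V`
vanishing on the kernel of the action is inner on `I`, and `I` has no nonzero invariants in `V`. -/
theorem LieDerivation.exists_inner_on_of_lie_eq_top [FiniteDimensional K V] (I : LieIdeal K U)
    (hI : ∀ x ∈ I, ∀ y ∈ I, ∀ w : V, ⁅⁅x, y⁆, w⁆ = 0)
    (hIV : ⁅I, (⊤ : LieSubmodule K U V)⁆ = ⊤) (D : LieDerivation K U V)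
    (hD : ∀ k : U, (∀ w : V, ⁅k, w⁆ = 0) → D k = 0) :
    (∃ w : V, ∀ x ∈ I, D x = ⁅x, w⁆) ∧ ∀ w : V, (∀ x ∈ I, ⁅x, w⁆ = 0) → w = 0 := by
  let S : Set (Module.End K V) := LieModule.toEnd K U V '' I
  have hcommS : ∀ x ∈ I, ∀ y ∈ I, ∀ w : V, ⁅x, ⁅y, w⁆⁆ = ⁅y, ⁅x, w⁆⁆ := by
    intro x hx y hy w
    have := hI x hx y hy w
    rwa [lie_lie, sub_eq_zero] at this
  have hS : ∀ a ∈ S, ∀ b ∈ S, a * b = b * a := by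
    rintro _ ⟨x, hx, rfl⟩ _ ⟨y, hy, rfl⟩
    ext w
    exact hcommS x hx y hy w
  let R := Algebra.adjoin K S
  have : IsMulCommutative R := Algebra.isMulCommutative_adjoin K hS
  have hRI : ∀ (r : R) (x : U), x ∈ I → ∀ w : V, r • ⁅x, w⁆ = ⁅x, r • w⁆ := by
    intro r x hx w
    have h1 : (⟨LieModule.toEnd K U V x, Algebra.subset_adjoin ⟨x, hx, rfl⟩⟩ : R) * r =
        r * ⟨LieModule.toEnd K U V x, Algebra.subset_adjoin ⟨x, hx, rfl⟩⟩ := mul_comm _ _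
    exact (LinearMap.congr_fun (congrArg Subtype.val h1) w).symm
  let J : Ideal R := Ideal.span {r : R | ∃ x ∈ I, (r : Module.End K V) = LieModule.toEnd K U V x}
  have hfin : Module.Finite R V := Module.Finite.of_restrictScalars_finite K R V
  have hJ : (⊤ : Submodule R V) ≤ J • (⊤ : Submodule R V) := by
    intro w _
    have hw : w ∈ (⁅I, (⊤ : LieSubmodule K U V)⁆ : LieSubmodule K U V) := by rw [hIV]; trivial
    rw [← LieSubmodule.mem_toSubmodule, LieSubmodule.lieIdeal_oper_eq_linear_span'] at hw
    induction hw using Submodule.span_induction with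
    | mem w hw =>
      obtain ⟨x, hx, m, -, rfl⟩ := hw
      exact Submodule.smul_mem_smul (r := (⟨LieModule.toEnd K U V x,
        Algebra.subset_adjoin ⟨x, hx, rfl⟩⟩ : R)) (n := m)
        (Ideal.subset_span ⟨x, hx, rfl⟩) trivial
    | zero => exact zero_mem _
    | add _ _ _ _ h1 h2 => exact add_mem (h1 trivial) (h2 trivial)
    | smul t _ _ h => exact Submodule.smul_of_tower_mem _ t (h trivial)
  -- Nakayama for the commutative operator algebra `R`: since `J V = V`, the element `1 - r` of `J`
  -- acts on `V` as the identity.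
  obtain ⟨r, hr, hrV⟩ := Submodule.exists_sub_one_mem_and_smul_eq_zero_of_fg_of_le_smul J ⊤
    hfin.fg_top hJ
  have hj : ∀ w : V, (1 - r) • w = w := fun w => by
    rw [sub_smul, one_smul, hrV w trivial, sub_zero]
  have hrJ : 1 - r ∈ J := by rw [← neg_sub]; exact neg_mem hr
  constructor
  · have key : ∀ j ∈ J, ∃ w : V, ∀ x ∈ I, j • D x = ⁅x, w⁆ := by
      intro j hj
      induction hj using Submodule.span_induction with
      | mem j hj =>
        obtain ⟨y, hy, hjy⟩ := hj
        refine ⟨D y, fun x hx => ?_⟩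
        -- Thus `⁅x, D y⁆ = ⁅y, D x⁆`, so `D y` is the witness for the operator of `y`; the rest
        -- follows by `R`-linearity.
        have h1 : D ⁅x, y⁆ = 0 := hD _ (hI x hx y hy)
        rw [LieDerivation.apply_lie_eq_sub, sub_eq_zero] at h1
        rw [h1]
        exact LinearMap.congr_fun hjy (D x)
      | zero => exact ⟨0, fun x _ => by rw [zero_smul, lie_zero]⟩
      | add a b _ _ h1 h2 =>
        obtain ⟨w, hw⟩ := h1
        obtain ⟨w', hw'⟩ := h2
        exact ⟨w + w', fun x hx => by rw [add_smul, lie_add, hw x hx, hw' x hx]⟩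
      | smul a b _ h =>
        obtain ⟨w, hw⟩ := h
        exact ⟨a • w, fun x hx => by rw [smul_assoc, hw x hx, hRI a x hx]⟩
    obtain ⟨w, hw⟩ := key _ hrJ
    exact ⟨w, fun x hx => by rw [← hw x hx, hj]⟩
  · intro w hw
    have key : ∀ j ∈ J, j • w = 0 := by
      intro j hj
      induction hj using Submodule.span_induction with
      | mem j hj =>
        obtain ⟨y, hy, hjy⟩ := hj
        exact (LinearMap.congr_fun hjy w).trans (hw y hy)
      | zero => exact zero_smul _ _
      | add a b _ _ h1 h2 => rw [add_smul, h1, h2, add_zero]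
      | smul a b _ h => rw [smul_assoc, h, smul_zero]
    rw [← hj w, key _ hrJ]

/-- A derivation from a soluble Lie algebra into a nontrivial irreducible module is inner if it
vanishes on the kernel of the action. -/
theorem LieDerivation.exists_inner_of_irreducible [FiniteDimensional K V]
    [LieAlgebra.IsSolvable U] (hV : ∃ (u : U) (w : V), ⁅u, w⁆ ≠ 0)
    (hirr : ∀ W : LieSubmodule K U V, W = ⊥ ∨ W = ⊤) (D : LieDerivation K U V)
    (hD : ∀ k : U, (∀ w : V, ⁅k, w⁆ = 0) → D k = 0) :
    ∃ w : V, ∀ x, D x = ⁅x, w⁆ := by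
  obtain ⟨I, ⟨u, hu, w, huw⟩, hI⟩ := LieAlgebra.exists_ideal_commute_of_isSolvable (K := K) hV
  have hIV : ⁅I, (⊤ : LieSubmodule K U V)⁆ = ⊤ := by
    refine (hirr _).resolve_left fun h => huw ?_
    have h1 : ⁅u, w⁆ ∈ ⁅I, (⊤ : LieSubmodule K U V)⁆ := LieSubmodule.lie_mem_lie hu trivial
    rwa [h, LieSubmodule.mem_bot] at h1
  obtain ⟨⟨v, hv⟩, hinv⟩ := D.exists_inner_on_of_lie_eq_top I hI hIV hD
  -- Since `D - ⁅·, v⁆` vanishes on the ideal `I`, evaluating it at `⁅x, y⁆` with `x ∈ I` shows that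
  -- its values are `I`-invariant, hence zero.
  refine ⟨v, fun y => sub_eq_zero.1 (hinv _ fun x hx => ?_)⟩
  have h1 := D.apply_lie_eq_sub x y
  rw [hv _ (lie_mem_left K U I x y hx), hv x hx, lie_lie] at h1
  rw [lie_sub]
  have h2 : ⁅x, D y⁆ - ⁅x, ⁅y, v⁆⁆ = (⁅x, D y⁆ - ⁅y, ⁅x, v⁆⁆) - (⁅x, ⁅y, v⁆⁆ - ⁅y, ⁅x, v⁆⁆) := by abel
  rw [h2, h1, sub_self]

end Cohomology

/-! ### Membership of split extensions in a formation -/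

/-- The projection of a Lie algebra onto its quotient by an ideal. -/
def LieIdeal.quotientHom {K : Type*} [Field K] {L : Type*} [LieRing L] [LieAlgebra K L]
    (I : LieIdeal K L) : L →ₗ⁅K⁆ L ⧸ I :=
  { I.toSubmodule.mkQ with map_lie' := rfl }

theorem LieIdeal.quotientHom_surjective {K : Type*} [Field K] {L : Type*} [LieRing L]
    [LieAlgebra K L] (I : LieIdeal K L) : Function.Surjective I.quotientHom :=
  Quot.mk_surjective

theorem LieIdeal.quotientHom_eq_zero {K : Type*} [Field K] {L : Type*} [LieRing L]
    [LieAlgebra K L] {I : LieIdeal K L} {x : L} : I.quotientHom x = 0 ↔ x ∈ I :=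
  LieSubmodule.Quotient.mk_eq_zero' (N := I)

theorem LieFormation.mem_of_quotient_bot {K : Type v} [Field K] (F : LieFormation.{u, v} K)
    {E : Type u} [LieRing E] [LieAlgebra K E] (h : F.Mem (E ⧸ (⊥ : LieIdeal K E))) : F.Mem E := by
  have hk : (LieHom.id : E →ₗ⁅K⁆ E).ker = ⊥ := LieHom.ker_eq_bot _ |>.2 Function.injective_id
  rw [← hk] at h
  refine F.of_surjective _ _ ((LieHom.id : E →ₗ⁅K⁆ E).range.incl.comp
    (LieHom.id : E →ₗ⁅K⁆ E).quotKerEquivRange.toLieHom) (fun x => ?_) h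
  exact ⟨LieSubmodule.Quotient.mk x, rfl⟩

/-- A soluble Lie algebra which is covered by a member of the formation modulo each of two ideals
intersecting trivially is in the formation. -/
theorem LieFormation.mem_of_inf_eq_bot {K : Type v} [Field K] (F : LieFormation.{u, v} K)
    {E U : Type u} [LieRing E] [LieAlgebra K E] [FiniteDimensional K E] [LieAlgebra.IsSolvable E]
    [LieRing U] [LieAlgebra K U] (hU : F.Mem U) {I J : LieIdeal K E} (hIJ : I ⊓ J = ⊥)
    (f : U →ₗ⁅K⁆ E) (hI : ∀ e, ∃ u, e - f u ∈ I) (hJ : ∀ e, ∃ u, e - f u ∈ J) : F.Mem E := by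
  have key : ∀ I : LieIdeal K E, (∀ e, ∃ u, e - f u ∈ I) → F.Mem (E ⧸ I) := by
    intro I hI
    refine F.of_surjective _ _ (I.quotientHom.comp f) (fun x => ?_) hU
    obtain ⟨e, rfl⟩ := I.quotientHom_surjective x
    obtain ⟨u, hu⟩ := hI e
    refine ⟨u, ?_⟩
    have := LieIdeal.quotientHom_eq_zero.2 hu
    rw [map_sub, sub_eq_zero] at this
    exact this.symm
  have h := F.quotient_inf E I J (key I hI) (key J hJ)
  rw [hIJ] at h
  exact F.mem_of_quotient_bot h

section SemiDirect

variable {K : Type*} [Field K] {V U : Type*} [LieRing V] [LieAlgebra K V] [LieRing U]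
  [LieAlgebra K U] (ψ : U →ₗ⁅K⁆ LieDerivation K V V)

/-- A derived term that vanishes in `U` lies in the abelian part `V`. Solubility is needed before
`LieFormation.quotient_inf` can be applied. -/
theorem LieAlgebra.SemiDirectSum.isSolvable_of_abelian [LieAlgebra.IsSolvable U]
    (hV : ∀ a b : V, ⁅a, b⁆ = 0) : LieAlgebra.IsSolvable (LieAlgebra.SemiDirectSum V U ψ) := by
  obtain ⟨k, hk⟩ := (LieAlgebra.isSolvable_iff K U).1 inferInstance
  refine (LieAlgebra.isSolvable_iff K _).2 ⟨k + 1, ?_⟩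
  have h0 : ∀ x ∈ LieAlgebra.derivedSeries K (LieAlgebra.SemiDirectSum V U ψ) k,
      x.right = 0 := by
    intro x hx
    have h1 := LieIdeal.derivedSeries_map_le (f := LieAlgebra.SemiDirectSum.projr ψ) k
      (LieIdeal.mem_map hx)
    rw [hk] at h1
    exact h1
  rw [LieAlgebra.derivedSeries_def, LieAlgebra.derivedSeriesOfIdeal_succ, eq_bot_iff,
    LieSubmodule.lie_le_iff]
  intro x hx y hy
  rw [LieSubmodule.mem_bot, LieAlgebra.SemiDirectSum.lie_eq_mk, h0 x hx, h0 y hy, hV]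
  simp

/-- The ideal `{(a, -k) | k ∈ ker ψ, D k = a}` of a semidirect sum, for a derivation `D`. -/
def LieAlgebra.SemiDirectSum.graphIdeal (hV : ∀ a b : V, ⁅a, b⁆ = 0) (D : U →ₗ[K] V)
    (hD : ∀ x y, D ⁅x, y⁆ = ψ x (D y) - ψ y (D x)) :
    LieIdeal K (LieAlgebra.SemiDirectSum V U ψ) where
  carrier := {e | ψ e.right = 0 ∧ D e.right = -e.left}
  add_mem' {a b} ha hb := by
    refine ⟨?_, ?_⟩
    · simp [ha.1, hb.1]
    · simp [ha.2, hb.2, add_comm]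
  zero_mem' := by simp
  smul_mem' t a ha := by
    refine ⟨?_, ?_⟩
    · simp [ha.1]
    · simp [ha.2]
  lie_mem {x a} ha := by
    have h1 : ψ a.right = 0 := ha.1
    have h2 : D a.right = -a.left := ha.2
    refine ⟨?_, ?_⟩
    · simp [h1]
    · simp [h1, h2, hV, hD]

end SemiDirect

/-- If a member `U` of the formation induces on the abelian chief factor `A/B` the same operators
as `L` and some derivation `U → A/B` maps the kernel of the action onto `A/B`, then `A/B` is
central for the formation. -/
theorem LieFormation.mem_factorSplitExtension_of_derivation {K : Type v} [Field K]
    (F : LieFormation.{u, v} K) {L U : Type u} [LieRing L] [LieAlgebra K L] [FiniteDimensional K L]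
    [LieRing U] [LieAlgebra K U] {A B : LieIdeal K L} (hAB : ∀ a b : A.Factor B, ⁅a, b⁆ = 0)
    (hU : F.Mem U) (f : U →ₗ⁅K⁆ L) (hf : ∀ l, ∃ u, A.factorAction B (l - f u) = 0)
    (D : U →ₗ[K] A.Factor B)
    (hD : ∀ x y, D ⁅x, y⁆ = A.factorAction B (f x) (D y) - A.factorAction B (f y) (D x))
    (hsurj : ∀ v, ∃ k, A.factorAction B (f k) = 0 ∧ D k = v) :
    F.Mem (A.FactorSplitExtension B) := by
  have := F.finiteDimensional U hU
  have := F.isSolvable U hU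
  let ψ : U →ₗ⁅K⁆ LieDerivation K (A.Factor B) (A.Factor B) := (A.factorAction B).comp f
  have := LieAlgebra.SemiDirectSum.isSolvable_of_abelian ψ hAB
  have : FiniteDimensional K (LieAlgebra.SemiDirectSum (A.Factor B) U ψ) :=
    Module.Finite.equiv (LieAlgebra.SemiDirectSum.toProdl ψ).symm
  have hE : F.Mem (LieAlgebra.SemiDirectSum (A.Factor B) U ψ) := by
    refine F.mem_of_inf_eq_bot hU (I := (LieAlgebra.SemiDirectSum.projr ψ).ker)
      (J := LieAlgebra.SemiDirectSum.graphIdeal ψ hAB D hD) ?_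
      (LieAlgebra.SemiDirectSum.inr ψ) (fun e => ⟨e.right, ?_⟩) fun e => ?_
    · rw [eq_bot_iff]
      rintro e ⟨h1, -, h2⟩
      replace h1 : e.right = 0 := h1
      rw [h1, map_zero, eq_comm, neg_eq_zero] at h2
      exact LieAlgebra.SemiDirectSum.ext h2 h1
    · rw [LieHom.mem_ker, map_sub, LieAlgebra.SemiDirectSum.projr_inr_apply]
      exact sub_self _
    -- Here `e - (0, e.right + k) = (e.left, -k)` lies in the graph ideal, so `U` covers the sum
    -- modulo that ideal too.
    · obtain ⟨k, hk, hkD⟩ := hsurj e.left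
      refine ⟨e.right + k, ?_, ?_⟩
      · simpa [ψ] using hk
      · simp [hkD]
  refine F.of_surjective _ (A.FactorSplitExtension B)
    { toFun := fun e => ⟨e.left, LieIdeal.quotientHom _ (f e.right)⟩
      map_add' := fun x y => by simp
      map_smul' := fun t x => by simp
      map_lie' := fun {x y} => by
        simp only [LieAlgebra.SemiDirectSum.lie_eq_mk, LieHom.map_lie]
        rfl } ?_ hE
  rintro ⟨a, l⟩
  obtain ⟨l, rfl⟩ := LieIdeal.quotientHom_surjective _ l
  obtain ⟨u, hu⟩ := hf l
  refine ⟨⟨a, u⟩, LieAlgebra.SemiDirectSum.ext rfl ?_⟩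
  have h1 := LieIdeal.quotientHom_eq_zero.2 (LieHom.mem_ker.2 hu)
  rw [map_sub, sub_eq_zero] at h1
  exact h1.symm

/-! ### Chief factors complemented by maximal subalgebras -/

section NilpotentIdeal

variable {K : Type*} [Field K] {L : Type*} [LieRing L] [LieAlgebra K L]

/-- A nilpotent ideal `I` not contained in `M` contains an ideal `A` not contained in `M` with
`⁅I, A⁆ ≤ M`. -/
theorem LieIdeal.exists_le_lie_le_of_isNilpotent (I : LieIdeal K L) [LieRing.IsNilpotent I]
    {M : Submodule K L} (hI : ¬ I.toSubmodule ≤ M) :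
    ∃ A : LieIdeal K L, A ≤ I ∧ ¬ A.toSubmodule ≤ M ∧ ∀ x ∈ I, ∀ a ∈ A, ⁅x, a⁆ ∈ M := by
  classical
  -- Iterated brackets with `I` are ideals of `L` inside the lower central terms of `I`; the last
  -- one outside `M` is taken.
  let C : ℕ → LieIdeal K L := fun k => (fun J => ⁅I, J⁆)^[k] I
  have hC : ∀ k, C (k + 1) = ⁅I, C k⁆ := fun k => Function.iterate_succ_apply' _ _ _
  have hCI : ∀ k, C k ≤ I := by
    intro k
    cases k with
    | zero => exact le_rfl
    | succ k => rw [hC]; exact LieSubmodule.lie_le_left _ _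
  have hlcs : ∀ k, (C k).toSubmodule ≤
      (LieModule.lowerCentralSeries K I I k).toSubmodule.map I.toSubmodule.subtype := by
    intro k
    induction k with
    | zero => exact fun x hx => ⟨⟨x, hx⟩, LieSubmodule.mem_top _, rfl⟩
    | succ k ih =>
      rw [hC, LieSubmodule.lieIdeal_oper_eq_linear_span', Submodule.span_le]
      rintro _ ⟨x, hx, y, hy, rfl⟩
      obtain ⟨y, hy', rfl⟩ := ih hy
      refine ⟨⁅(⟨x, hx⟩ : I), y⁆, ?_, rfl⟩
      rw [LieModule.lowerCentralSeries_succ]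
      exact LieSubmodule.lie_mem_lie (LieSubmodule.mem_top _) hy'
  obtain ⟨k, hk⟩ := (LieModule.isNilpotent_iff K I I).1 inferInstance
  have hex : ∃ k, (C k).toSubmodule ≤ M := ⟨k, (hlcs k).trans (by rw [hk]; simp)⟩
  have hs := Nat.find_spec hex
  have hm := fun j => Nat.find_min hex (m := j)
  rcases hj : Nat.find hex with _ | j
  · rw [hj] at hs
    exact absurd hs hI
  · rw [hj] at hs
    refine ⟨C j, hCI j, hm j (by omega), fun x hx a ha => hs ?_⟩
    rw [hC]
    exact LieSubmodule.lie_mem_lie hx ha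

theorem LieSubalgebra.sup_ideal_eq_top_of_isCoatom {M : LieSubalgebra K L} (hM : IsCoatom M)
    {A : LieIdeal K L} (hA : ¬ A.toSubmodule ≤ M.toSubmodule) :
    M.toSubmodule ⊔ A.toSubmodule = ⊤ := by
  let S : LieSubalgebra K L :=
    { M.toSubmodule ⊔ A.toSubmodule with
      lie_mem' := fun {x y} hx hy => by
        obtain ⟨m, hm, a, ha, rfl⟩ := Submodule.mem_sup.1 hx
        obtain ⟨m', hm', a', ha', rfl⟩ := Submodule.mem_sup.1 hy
        rw [lie_add, add_lie m a m', add_assoc]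
        exact Submodule.add_mem_sup (M.lie_mem hm hm')
          (add_mem (lie_mem_left K L A _ _ ha) (lie_mem_right K L A _ _ ha')) }
  have hS : S = ⊤ := hM.2 S (lt_of_le_not_ge (fun x hx => Submodule.mem_sup_left hx)
    fun h => hA fun a ha => h (show a ∈ S from Submodule.mem_sup_right ha))
  exact congrArg LieSubalgebra.toSubmodule hS

/-- If a maximal subalgebra `M` is supplemented by an ideal `A` with `⁅A, A⁆ ≤ M`, the `M`-module
`L/M` is irreducible. -/
theorem LieSubalgebra.eq_or_eq_top_of_isCoatom {M : LieSubalgebra K L} (hM : IsCoatom M)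
    {A : LieIdeal K L} (hMA : M.toSubmodule ⊔ A.toSubmodule = ⊤)
    (hA : ∀ a ∈ A, ∀ b ∈ A, ⁅a, b⁆ ∈ M) {W : Submodule K L} (hMW : M.toSubmodule ≤ W)
    (hW : ∀ m ∈ M, ∀ w ∈ W, ⁅m, w⁆ ∈ W) : W = M.toSubmodule ∨ W = ⊤ := by
  let S : LieSubalgebra K L :=
    { W with
      lie_mem' := fun {x y} hx hy => by
        obtain ⟨m, hm, a, ha, rfl⟩ := Submodule.mem_sup.1 (hMA.ge (Submodule.mem_top : x ∈ ⊤))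
        obtain ⟨n, hn, b, hb, rfl⟩ := Submodule.mem_sup.1 (hMA.ge (Submodule.mem_top : y ∈ ⊤))
        have ha' : a ∈ W := (add_mem_cancel_left (hMW hm)).1 hx
        rw [add_lie, lie_add a]
        refine add_mem (hW m hm _ hy) (add_mem ?_ (hMW (hA a ha b hb)))
        rw [← lie_skew]
        exact neg_mem (hW n hn a ha') }
  rcases eq_or_ne S ⊤ with h | h
  · exact Or.inr (congrArg LieSubalgebra.toSubmodule h)
  · refine Or.inl (congrArg LieSubalgebra.toSubmodule
      (?_ : S = M))
    by_contra hne
    exact h (hM.2 S (lt_of_le_of_ne hMW (Ne.symm hne)))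

/-- A maximal subalgebra supplementing a nilpotent ideal complements a chief factor `A/B` with `A`
nilpotent and `⁅A, A⁆ ≤ B`. -/
theorem LieSubalgebra.exists_chief_factor_of_isCoatom {M : LieSubalgebra K L} (hM : IsCoatom M)
    (hN : M.toSubmodule ⊔ (LieAlgebra.nilpotentRadical K L).toSubmodule = ⊤) :
    ∃ A B : LieIdeal K L, LieRing.IsNilpotent A ∧ (∀ a ∈ A, ∀ b ∈ A, ⁅a, b⁆ ∈ M) ∧ B ⋖ A ∧
      M.toSubmodule ⊔ A.toSubmodule = ⊤ ∧ M.toSubmodule ⊓ A.toSubmodule = B.toSubmodule := by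
  have hex : ∃ I : LieIdeal K L, LieRing.IsNilpotent I ∧ ¬ I.toSubmodule ≤ M.toSubmodule := by
    by_contra! h
    refine hM.1 ?_
    rw [← LieSubalgebra.toSubmodule_inj]
    refine (sup_eq_left.2 ?_).symm.trans hN
    rw [LieAlgebra.nilpotentRadical, LieSubmodule.sSup_toSubmodule]
    refine sSup_le ?_
    rintro _ ⟨I, hI, rfl⟩
    exact h I hI
  obtain ⟨I, hInil, hI⟩ := hex
  obtain ⟨A, hAI, hAM, hIA⟩ := I.exists_le_lie_le_of_isNilpotent hI
  have hMA := M.sup_ideal_eq_top_of_isCoatom hM hAM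
  have hA : ∀ a ∈ A, ∀ b ∈ A, ⁅a, b⁆ ∈ M := fun a ha b hb => hIA a (hAI ha) b hb
  let B : LieIdeal K L :=
    { M.toSubmodule ⊓ A.toSubmodule with
      lie_mem := fun {x b} hb => by
        refine ⟨?_, lie_mem_right K L A x b hb.2⟩
        obtain ⟨m, hm, a, ha, rfl⟩ := Submodule.mem_sup.1 (hMA.ge (Submodule.mem_top : x ∈ ⊤))
        rw [add_lie]
        exact add_mem (M.lie_mem hm hb.1) (hA a ha b hb.2) }
  have hBA : B ≤ A := fun x hx => hx.2
  refine ⟨A, B, (LieIdeal.inclusion_injective hAI).lieAlgebra_isNilpotent, hA,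
    ⟨lt_of_le_not_ge hBA fun h => hAM fun a ha => (h ha).1, fun J hBJ hJA => ?_⟩, hMA, rfl⟩
  -- By irreducibility `M + J` is `M` or `L`; intersecting with `A` gives `J = B` or `J = A`.
  rcases M.eq_or_eq_top_of_isCoatom hM hMA hA (W := M.toSubmodule ⊔ J.toSubmodule) le_sup_left
    (fun m hm w hw => by
      obtain ⟨n, hn, j, hj, rfl⟩ := Submodule.mem_sup.1 hw
      rw [lie_add]
      exact Submodule.add_mem_sup (M.lie_mem hm hn) (lie_mem_right K L J m j hj)) with h | h
  · exact hBJ.not_ge fun j hj => ⟨h.le (Submodule.mem_sup_right hj), hJA.le hj⟩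
  · refine hJA.not_ge fun a ha => ?_
    obtain ⟨m, hm, j, hj, rfl⟩ := Submodule.mem_sup.1 (h.ge (Submodule.mem_top : a ∈ ⊤))
    refine add_mem (hBJ.le ⟨hm, ?_⟩) hj
    have := sub_mem ha (hJA.le hj)
    rwa [add_sub_cancel_right] at this

end NilpotentIdeal

/-! ### Critical subalgebras yield irreducible steps -/

/-- A nonzero soluble Lie algebra has a nonzero character. -/
theorem LieAlgebra.exists_character_ne_zero {K : Type*} [Field K] (U : Type*) [LieRing U]
    [LieAlgebra K U] [LieAlgebra.IsSolvable U] [Nontrivial U] :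
    ∃ χ : U →ₗ[K] K, (∃ x, χ x = 1) ∧ ∀ x y : U, χ ⁅x, y⁆ = 0 := by
  have h := LieAlgebra.derivedSeries_lt_top_of_solvable K U
  obtain ⟨x, -, hx⟩ := SetLike.exists_of_lt h
  obtain ⟨χ, hχx, hχ⟩ := Submodule.exists_le_ker_of_notMem
    (p := (LieAlgebra.derivedSeries K U 1).toSubmodule) hx
  refine ⟨(χ x)⁻¹ • χ, ⟨x, by simp [hχx]⟩, fun y z => ?_⟩
  have : χ ⁅y, z⁆ = 0 := hχ (by
    change ⁅y, z⁆ ∈ LieAlgebra.derivedSeries K U 1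
    rw [LieAlgebra.derivedSeries_def, LieAlgebra.derivedSeriesOfIdeal_succ]
    exact LieSubmodule.lie_mem_lie (LieSubmodule.mem_top _) (LieSubmodule.mem_top _))
  simp [this]

section Projection

variable {K : Type v} [Field K] {L : Type u} [LieRing L] [LieAlgebra K L]

/-- The projection of `L` onto `A/B` along a complement `M` of `A/B`. -/
theorem LieIdeal.exists_factor_projection {A B : LieIdeal K L} {M : Submodule K L}
    (hMA : M ⊔ A.toSubmodule = ⊤) (hB : M ⊓ A.toSubmodule = B.toSubmodule) :
    ∃ π : L →ₗ[K] A.Factor B, (∀ x, π x = 0 ↔ x ∈ M) ∧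
      ∀ a : A, π a = LieSubmodule.Quotient.mk a := by
  have hmem : ∀ a : A, a ∈ LieIdeal.comap A.incl B ↔ (a : L) ∈ M := fun a => by
    have : (a : L) ∈ B.toSubmodule ↔ (a : L) ∈ M := by
      rw [← hB]; exact ⟨fun h => h.1, fun h => ⟨h, a.2⟩⟩
    exact this
  let q : A.Factor B →ₗ[K] L ⧸ M :=
    (LieIdeal.comap A.incl B).toSubmodule.liftQ (M.mkQ.comp A.toSubmodule.subtype) fun a ha =>
      (Submodule.Quotient.mk_eq_zero M).2 ((hmem a).1 ha)
  have hq : ∀ a : A, q (LieSubmodule.Quotient.mk a) = M.mkQ a := fun _ => rfl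
  have hinj : Function.Injective q := by
    rw [injective_iff_map_eq_zero]
    intro v hv
    obtain ⟨a, rfl⟩ := Submodule.Quotient.mk_surjective _ v
    exact (LieSubmodule.Quotient.mk_eq_zero' (N := LieIdeal.comap A.incl B)).2
      ((hmem a).2 ((Submodule.Quotient.mk_eq_zero M).1 hv))
  have hsurj : Function.Surjective q := by
    intro v
    obtain ⟨x, rfl⟩ := M.mkQ_surjective v
    obtain ⟨m, hm, a, ha, rfl⟩ := Submodule.mem_sup.1 (hMA.ge (Submodule.mem_top : x ∈ ⊤))
    refine ⟨LieSubmodule.Quotient.mk (⟨a, ha⟩ : A), ?_⟩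
    rw [hq, map_add, show M.mkQ m = 0 from (Submodule.Quotient.mk_eq_zero M).2 hm, zero_add]
  let e := LinearEquiv.ofBijective q ⟨hinj, hsurj⟩
  refine ⟨e.symm.toLinearMap.comp M.mkQ, fun x => ?_, fun a => ?_⟩
  · rw [LinearMap.comp_apply, LinearEquiv.coe_coe, LinearEquiv.map_eq_zero_iff]
    exact Submodule.Quotient.mk_eq_zero M
  · rw [LinearMap.comp_apply, LinearEquiv.coe_coe, LinearEquiv.symm_apply_eq]
    rfl

end Projection

/-- The module structure on a Lie algebra `V` given by an action by derivations. -/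
abbrev LieHom.derivationLieRingModule {K U V : Type*} [Field K] [LieRing U] [LieAlgebra K U]
    [LieRing V] [LieAlgebra K V] (ψ : U →ₗ⁅K⁆ LieDerivation K V V) : LieRingModule U V where
  bracket x v := ψ x v
  add_lie x y v := by simp
  lie_add x v w := by simp
  leibniz_lie x y v := by
    change ψ x (ψ y v) = ψ ⁅x, y⁆ v + ψ y (ψ x v)
    rw [LieHom.map_lie, LieDerivation.commutator_apply]
    abel

namespace LieFormation

variable {K : Type v} [Field K] (F : LieFormation.{u, v} K) {L : Type u} [LieRing L]
  [LieAlgebra K L]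

/-- A derivation of a nonzero member `U` of the formation into an abelian irreducible factor `A/B`
on which `U` and `L` induce the same operators is inner, unless `A/B` is central for the
formation. -/
theorem exists_inner_of_not_mem_factorSplitExtension [FiniteDimensional K L] {U : Type u}
    [LieRing U] [LieAlgebra K U] [Nontrivial U] {A B : LieIdeal K L}
    (hAB : ∀ a b : A.Factor B, ⁅a, b⁆ = 0) (hU : F.Mem U) (f : U →ₗ⁅K⁆ L)
    (hf : ∀ l, ∃ u, A.factorAction B (l - f u) = 0)
    (hirr : ∀ W : Submodule K (A.Factor B),
      (∀ u, ∀ w ∈ W, A.factorAction B (f u) w ∈ W) → W = ⊥ ∨ W = ⊤)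
    (hF : ¬ F.Mem (A.FactorSplitExtension B)) (D : U →ₗ[K] A.Factor B)
    (hD : ∀ x y, D ⁅x, y⁆ = A.factorAction B (f x) (D y) - A.factorAction B (f y) (D x)) :
    ∃ w, ∀ x, D x = A.factorAction B (f x) w := by
  have := F.finiteDimensional U hU
  have := F.isSolvable U hU
  let : LieRingModule U (A.Factor B) :=
    LieHom.derivationLieRingModule ((A.factorAction B).comp f)
  have hlie : ∀ (x : U) (v : A.Factor B), ⁅x, v⁆ = A.factorAction B (f x) v := fun _ _ => rfl
  let : LieModule K U (A.Factor B) :=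
    { smul_lie := fun t x v => by simp [hlie]
      lie_smul := fun t x v => by simp [hlie] }
  by_cases hV : ∃ (u : U) (w : A.Factor B), ⁅u, w⁆ ≠ 0
  · have hker : ∀ k : U, (∀ w : A.Factor B, ⁅k, w⁆ = 0) → D k = 0 := by
      by_contra! hk
      obtain ⟨k₀, hk₀, hDk₀⟩ := hk
      refine hF (F.mem_factorSplitExtension_of_derivation hAB hU f hf D hD ?_)
      -- For `k` in the kernel, `D ⁅u, k⁆ = ⁅u, D k⁆`; so the image of the kernel is a submodule,
      -- nonzero and hence everything.
      let W : Submodule K (A.Factor B) := ((A.factorAction B).comp f).ker.toSubmodule.map D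
      have hW : W = ⊤ := by
        refine (hirr W ?_).resolve_left fun h => hDk₀ ?_
        · rintro u _ ⟨k, hk, rfl⟩
          refine ⟨⁅u, k⁆, lie_mem_right K U _ u k hk, ?_⟩
          have hk' : A.factorAction B (f k) = 0 := hk
          rw [hD, hk', LieDerivation.zero_apply, sub_zero]
        · have : D k₀ ∈ W := ⟨k₀, LieDerivation.ext fun w => hk₀ w, rfl⟩
          rwa [h] at this
      intro v
      obtain ⟨k, hk, hkv⟩ := (hW.ge trivial : v ∈ W)
      exact ⟨k, hk, hkv⟩
    obtain ⟨w, hw⟩ := LieDerivation.exists_inner_of_irreducible hV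
      (fun W => (hirr W.toSubmodule fun u w hw => W.lie_mem hw).imp
        (fun h => by rwa [← LieSubmodule.bot_toSubmodule (L := U), LieSubmodule.toSubmodule_inj] at h)
        (fun h => by rwa [← LieSubmodule.top_toSubmodule (L := U), LieSubmodule.toSubmodule_inj] at h))
      (⟨D, hD⟩ : LieDerivation K U (A.Factor B)) hker
    exact ⟨w, hw⟩
  · push Not at hV
    have hV' : ∀ u : U, A.factorAction B (f u) = 0 := fun u => LieDerivation.ext fun w => hV u w
    refine absurd ?_ hF
    obtain ⟨χ, ⟨x₀, hx₀⟩, hχ⟩ := LieAlgebra.exists_character_ne_zero (K := K) U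
    have hone : ∃ a₀ : A.Factor B, ∀ v, ∃ t : K, t • a₀ = v := by
      by_cases h0 : ∃ a₀ : A.Factor B, a₀ ≠ 0
      · obtain ⟨a₀, ha₀⟩ := h0
        have h1 : (K ∙ a₀) = ⊤ := by
          refine (hirr _ fun u w hw => ?_).resolve_left
            fun h => ha₀ (Submodule.span_singleton_eq_bot.1 h)
          rw [hV', LieDerivation.zero_apply]
          exact zero_mem _
        exact ⟨a₀, fun v => Submodule.mem_span_singleton.1 (h1.ge trivial)⟩
      · push Not at h0
        exact ⟨0, fun v => ⟨0, by rw [h0 v, smul_zero]⟩⟩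
    obtain ⟨a₀, ha₀⟩ := hone
    -- Under the trivial action the factor is at most a line and the kernel is all of `U`, so a
    -- character serves as the surjective derivation, in place of `D`.
    refine F.mem_factorSplitExtension_of_derivation hAB hU f hf (χ.smulRight a₀)
      (fun x y => by simp [hχ, hV']) fun v => ?_
    obtain ⟨t, rfl⟩ := ha₀ v
    exact ⟨t • x₀, hV' _, by simp [hx₀]⟩

/-- A critical subalgebra containing a nonzero member `U` of the formation gives an irreducible
step. -/
theorem IsCritical.exists_isIrreducibleStep {F : LieFormation.{u, v} K} [FiniteDimensional K L] {M : LieSubalgebra K L}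
    (hM : F.IsCritical M) {U : LieSubalgebra K L} [Nontrivial U] (hU : F.Mem U) (hUM : U ≤ M) :
    ∃ A : LieSubalgebra K L, LieSubalgebra.IsIrreducibleStep U ⊤ M A := by
  obtain ⟨A, B, hAnil, hA, hBA, hMA, hB⟩ :=
    LieSubalgebra.exists_chief_factor_of_isCoatom hM.1.1 hM.2
  have hF : ¬ F.Mem (A.FactorSplitExtension B) := fun h =>
    hM.1.2 ⟨hM.1.1, A, B, ⟨hBA, h⟩, hMA, hB⟩
  have hirr := fun (W : Submodule K L) => M.eq_or_eq_top_of_isCoatom hM.1.1 hMA hA (W := W)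
  refine ⟨A.toLieSubalgebra, le_top, le_top, fun x _ a ha => lie_mem_right K L A x a ha,
    hAnil, fun x _ => ?_, fun W hMW _ hW => hirr W hMW hW, ?_⟩
  · obtain ⟨m, hm, a, ha, h⟩ := Submodule.mem_sup.1 (hMA.ge (Submodule.mem_top : x ∈ ⊤))
    exact ⟨m, hm, a, ha, h⟩
  intro hcov δ _ hδ
  obtain ⟨π, hπ, hπA⟩ := LieIdeal.exists_factor_projection hMA hB
  have hsurj : Function.Surjective π := fun v => by
    obtain ⟨a, rfl⟩ := Submodule.Quotient.mk_surjective _ v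
    exact ⟨a, hπA a⟩
  have hAB : ∀ a b : A.Factor B, ⁅a, b⁆ = 0 := by
    intro a b
    obtain ⟨a, rfl⟩ := Submodule.Quotient.mk_surjective _ a
    obtain ⟨b, rfl⟩ := Submodule.Quotient.mk_surjective _ b
    refine (hπA ⁅a, b⁆).symm.trans ((hπ _).2 ?_)
    exact hA a a.2 b b.2
  have hequiv : ∀ m ∈ M, ∀ x, π ⁅m, x⁆ = A.factorAction B m (π x) := by
    intro m hm x
    obtain ⟨n, hn, a, ha, rfl⟩ := Submodule.mem_sup.1 (hMA.ge (Submodule.mem_top : x ∈ ⊤))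
    rw [lie_add, map_add, map_add, (hπ _).2 (M.lie_mem hm hn), (hπ _).2 hn, zero_add, zero_add]
    exact (hπA (⁅m, (⟨a, ha⟩ : A)⁆)).trans (by rw [hπA ⟨a, ha⟩]; rfl)
  have hzero : ∀ c : L, (∀ a : A, ⁅c, (a : L)⁆ ∈ M) → A.factorAction B c = 0 := by
    intro c hc
    refine LieDerivation.ext fun v => ?_
    obtain ⟨a, rfl⟩ := Submodule.Quotient.mk_surjective _ v
    exact (hπA ⁅c, a⁆).symm.trans ((hπ _).2 (hc a))
  -- `L = M + A`, where `A` acts trivially on `A/B` and `M` acts there through `U`.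
  have hf : ∀ l : L, ∃ u : U, A.factorAction B (l - U.incl u) = 0 := by
    intro l
    obtain ⟨m, hm, a, ha, rfl⟩ := Submodule.mem_sup.1 (hMA.ge (Submodule.mem_top : l ∈ ⊤))
    obtain ⟨u, hu, c, -, hc, rfl⟩ := hcov m hm
    refine ⟨⟨u, hu⟩, hzero _ fun b => ?_⟩
    have h1 : u + c + a - U.incl ⟨u, hu⟩ = c + a := by
      change u + c + a - u = c + a
      abel
    rw [h1, add_lie]
    exact add_mem (hc b trivial) (hA a ha b b.2)
  obtain ⟨w, hw⟩ := F.exists_inner_of_not_mem_factorSplitExtension hAB hU U.incl hf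
    (fun W hW => by
      rcases hirr (W.comap π) (fun m hm => by
          rw [Submodule.mem_comap, (hπ m).2 hm]; exact zero_mem _) (fun m hm x hx => by
          obtain ⟨u, hu, c, -, hc, rfl⟩ := hcov m hm
          rw [add_lie]
          refine add_mem ?_ ?_
          · rw [Submodule.mem_comap, hequiv u (hUM hu)]
            exact hW ⟨u, hu⟩ _ hx
          · rw [Submodule.mem_comap, (hπ _).2 (hc x trivial)]
            exact zero_mem _) with h | h
      · left
        rw [eq_bot_iff]
        intro v hv
        obtain ⟨x, rfl⟩ := hsurj v
        exact (hπ x).2 (h.le hv)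
      · right
        rw [eq_top_iff]
        intro v _
        obtain ⟨x, rfl⟩ := hsurj v
        exact (h.ge trivial : x ∈ W.comap π))
    hF (π.comp δ) (fun x y => by
      have h1 := (hπ _).2 (hδ x y)
      rw [map_sub, map_sub, sub_eq_zero, hequiv _ (hUM x.2), hequiv _ (hUM y.2)] at h1
      exact h1)
  obtain ⟨p, rfl⟩ := hsurj w
  refine ⟨p, trivial, fun x => (hπ _).1 ?_⟩
  rw [map_sub, hequiv _ (hUM x.2), sub_eq_zero]
  exact hw x

end LieFormation

/-! ### Transport of chains to a larger algebra, and the theorem -/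

section Map

variable {K : Type*} [Field K] {X G : Type*} [LieRing X] [LieAlgebra K X] [LieRing G]
  [LieAlgebra K G]

theorem LieSubalgebra.map_comap_incl_of_le {P Q : LieSubalgebra K G} (h : Q ≤ P) :
    (Q.comap P.incl).map P.incl = Q := by
  ext x
  rw [LieSubalgebra.mem_map]
  exact ⟨fun ⟨y, hy, h⟩ => h ▸ hy, fun hx => ⟨⟨x, h hx⟩, hx, rfl⟩⟩

/-- Injective homomorphisms preserve irreducible steps. -/
theorem LieSubalgebra.IsIrreducibleStep.map {U P M A : LieSubalgebra K X}
    (h : IsIrreducibleStep U P M A) {j : X →ₗ⁅K⁆ G} (hj : Function.Injective j) :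
    IsIrreducibleStep (U.map j) (P.map j) (M.map j) (A.map j) := by
  have hmap : ∀ {S : LieSubalgebra K X} {x : X}, j x ∈ S.map j ↔ x ∈ S := fun {S x} => by
    rw [LieSubalgebra.mem_map]
    exact ⟨fun ⟨y, hy, h⟩ => hj h ▸ hy, fun hx => ⟨x, hx, rfl⟩⟩
  have hmono : ∀ {S T : LieSubalgebra K X}, S ≤ T → S.map j ≤ T.map j := fun hST => by
    rintro _ ⟨x, hx, rfl⟩
    exact ⟨x, hST hx, rfl⟩
  -- A linear left inverse suffices to pull derivations back, since their values lie in the image of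
  -- `j`.
  obtain ⟨g, hg⟩ := LinearMap.exists_leftInverse_of_injective (j : X →ₗ[K] G)
    (LinearMap.ker_eq_bot.2 hj)
  replace hg : ∀ x, g (j x) = x := fun x => LinearMap.congr_fun hg x
  refine ⟨hmono h.le, hmono h.ideal_le, ?_, ?_, ?_, ?_, ?_⟩
  · rintro _ ⟨x, hx, rfl⟩ _ ⟨a, ha, rfl⟩
    exact ⟨⁅x, a⁆, h.lie_mem x hx a ha, j.map_lie x a⟩
  · have := h.isNilpotent
    exact (LieEquiv.nilpotent_iff_equiv_nilpotent (A.equivMapOfInjective j hj)).1 this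
  · rintro _ ⟨x, hx, rfl⟩
    obtain ⟨m, hm, a, ha, rfl⟩ := h.exists_add x hx
    exact ⟨j m, hmap.2 hm, j a, hmap.2 ha, (j.map_add m a).symm⟩
  · intro W hMW hWP hW
    rcases h.irreducible (W.comap (j : X →ₗ[K] G)) (fun m hm => hMW (hmap.2 hm))
        (fun x hx => hmap.1 (hWP hx)) (fun m hm w hw => by
          change j ⁅m, w⁆ ∈ W
          rw [j.map_lie]
          exact hW _ (hmap.2 hm) _ hw) with h1 | h1
    · left
      refine le_antisymm (fun w hw => ?_) hMW
      obtain ⟨x, -, rfl⟩ := hWP hw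
      exact hmap.2 (h1.le hw)
    · right
      refine le_antisymm hWP ?_
      rintro _ ⟨x, hx, rfl⟩
      exact h1.ge hx
  · intro hcov δ hδP hδ
    have hδg : ∀ y, j (g (δ y)) = δ y := fun y => by
      obtain ⟨x, -, hx⟩ := hδP y
      rw [← hx]
      exact congrArg j (hg x)
    let i : U →ₗ[K] U.map j := (U.equivMapOfInjective j hj).toLinearEquiv.toLinearMap
    have hi : ∀ u : U, ((i u : U.map j) : G) = j u := fun _ => rfl
    obtain ⟨p, hp, hpM⟩ := h.exists_inner (fun m hm => by
        obtain ⟨_, ⟨x, hx, rfl⟩, _, ⟨c, hc, rfl⟩, hcP, hxc⟩ := hcov (j m) (hmap.2 hm)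
        refine ⟨x, hx, c, hc, fun y hy => ?_, hj ((j.map_add x c).trans hxc)⟩
        have := hcP (j y) (hmap.2 hy)
        exact hmap.1 ((j.map_lie c y).symm ▸ this)) ((g.comp δ).comp i)
      (fun u => hmap.1 (by
        change j (g (δ (i u))) ∈ _
        rw [hδg]
        exact hδP _)) (fun x y => hmap.1 (by
        change j (g (δ (i ⁅x, y⁆)) - (⁅(x : X), g (δ (i y))⁆ - ⁅(y : X), g (δ (i x))⁆)) ∈ _
        rw [map_sub, map_sub, j.map_lie, j.map_lie, hδg, hδg, hδg]
        have h1 : i ⁅x, y⁆ = ⁅i x, i y⁆ := (U.equivMapOfInjective j hj).map_lie x y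
        rw [h1]
        exact hδ (i x) (i y)))
    refine ⟨j p, hmap.2 hp, ?_⟩
    rintro ⟨_, u, hu, rfl⟩
    have := hmap.2 (hpM ⟨u, hu⟩)
    change j (g (δ (i ⟨u, hu⟩)) - ⁅u, p⁆) ∈ _ at this
    rw [map_sub, hδg, j.map_lie] at this
    exact this

end Map

/-- A nonzero normaliser is the bottom of a chain of irreducible steps. -/
theorem LieFormation.IsNormaliser.exists_chain {K : Type v} [Field K] {F : LieFormation.{u, v} K}
    {L : Type u} [LieRing L] [LieAlgebra K L] [FiniteDimensional K L] {U : LieSubalgebra K L}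
    [Nontrivial U] (hU : F.IsNormaliser U) :
    ∃ (n : ℕ) (M A : ℕ → LieSubalgebra K L), M 0 = ⊤ ∧ M n = U ∧
      ∀ k < n, LieSubalgebra.IsIrreducibleStep U (M k) (M (k + 1)) (A k) := by
  obtain ⟨hUF, n, M, h0, hn, hM⟩ := hU
  have hUM : ∀ k ≤ n, U ≤ M k := fun k hk => by
    induction hk using Nat.decreasingInduction with
    | self => exact hn.ge
    | of_succ k hk ih => exact ih.trans (hM k hk).1.le
  have hstep : ∀ k, ∃ A, k < n → LieSubalgebra.IsIrreducibleStep U (M k) (M (k + 1)) A := by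
    intro k
    by_cases hk : k < n
    · let e : U →ₗ⁅K⁆ U.comap (M k).incl :=
        { toFun := fun u => ⟨⟨u, hUM k hk.le u.2⟩, u.2⟩
          map_add' := fun _ _ => rfl
          map_smul' := fun _ _ => rfl
          map_lie' := rfl }
      have he : Function.Bijective e :=
        ⟨fun x y hxy => Subtype.ext (congrArg (fun z : U.comap (M k).incl => ((z : M k) : L)) hxy),
          fun x => ⟨⟨x, x.2⟩, rfl⟩⟩
      have : Nontrivial (U.comap (M k).incl) := he.1.nontrivial
      obtain ⟨A, hA⟩ := (hM k hk).2.exists_isIrreducibleStep (U := U.comap (M k).incl)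
        (F.of_surjective _ _ e he.2 hUF) (fun x hx => hUM (k + 1) hk hx)
      refine ⟨A.map (M k).incl, fun _ => ?_⟩
      have h1 := hA.map (j := (M k).incl) Subtype.val_injective
      have h2 : (⊤ : LieSubalgebra K (M k)).map (M k).incl = M k := by
        ext x
        rw [LieSubalgebra.mem_map]
        exact ⟨fun ⟨y, _, hy⟩ => hy ▸ y.2, fun hx => ⟨⟨x, hx⟩, trivial, rfl⟩⟩
      rwa [LieSubalgebra.map_comap_incl_of_le (hUM k hk.le), h2,
        LieSubalgebra.map_comap_incl_of_le (hM k hk).1.le] at h1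
    · exact ⟨⊥, fun h => absurd h hk⟩
  choose A hA using hstep
  exact ⟨n, M, A, h0, hn, hA⟩

theorem mainTheorem1 {K : Type v} [Field K] (F : LieFormation.{u, v} K) (hF : F.IsSaturated)
    {L : Type u} [LieRing L] [LieAlgebra K L] [FiniteDimensional K L] [LieAlgebra.IsSolvable L]
    (U : LieSubalgebra K L) (hU : F.IsNormaliser U) : U.IsIntravariant := by
  intro D
  -- A zero `U` has no nonzero character, so the step lemma excludes it; every derivation stabilises
  -- it anyway.
  rcases subsingleton_or_nontrivial U with hsub | hnt
  · refine ⟨0, D, by simp, fun y hy => ?_⟩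
    have : y = 0 := congrArg Subtype.val (Subsingleton.elim (⟨y, hy⟩ : U) 0)
    rw [this, map_zero]
    exact zero_mem _
  obtain ⟨n, M, A, h0, hn, hM⟩ := hU.exists_chain
  -- With the tautological action, `D` is realised by the element `inr ψ D`, which normalises the
  -- image of `L`.
  let ψ : LieDerivation K L L →ₗ⁅K⁆ LieDerivation K L L := LieHom.id
  have : FiniteDimensional K (LieAlgebra.SemiDirectSum L (LieDerivation K L L) ψ) :=
    Module.Finite.equiv (LieAlgebra.SemiDirectSum.toProdl ψ).symm
  let j := LieAlgebra.SemiDirectSum.inl ψ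
  have hj : Function.Injective j := LieAlgebra.SemiDirectSum.inl_injective ψ
  have hd : ∀ x, ⁅LieAlgebra.SemiDirectSum.inr ψ D, j x⁆ = j (D x) := fun x => by simp [j, ψ]
  obtain ⟨_, ⟨x, -, rfl⟩, hx⟩ := LieSubalgebra.exists_sub_normalises_of_chain
    (fun k => (M k).map j) (fun k => (A k).map j) (fun k hk => (hM k hk).map hj)
    (congrArg (LieSubalgebra.map j) hn) (LieAlgebra.SemiDirectSum.inr ψ D) (by
      rintro _ ⟨x, -, rfl⟩
      exact ⟨D x, h0 ▸ LieSubalgebra.mem_top _, (hd x).symm⟩)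
  refine ⟨x, D - LieDerivation.ad K L x, by abel, fun y hy => ?_⟩
  obtain ⟨z, hz, hzy⟩ := hx (j y) ⟨y, hy, rfl⟩
  have h1 : ⁅LieAlgebra.SemiDirectSum.inr ψ D - j x, j y⁆ = j (D y - ⁅x, y⁆) := by
    rw [sub_lie, hd, map_sub, j.map_lie]
  have h2 : z = D y - ⁅x, y⁆ := hj (hzy.trans h1)
  rw [LieDerivation.sub_apply, LieDerivation.ad_apply_apply, ← h2]
  exact hz
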